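/- For a positive integer $N$ write $[N]=\{1,\dots,N\}$ and let $\mathsf{GT}_N:[N]\times[N]\to\{0,1\}$ be given by $\mathsf{GT}_N(x,y)=1$ if $x>y$ and $\mathsf{GT}_N(x,y)=0$ if $x\le y$. Consider quantum query algorithms for ordered search: there is an unknown $x\in[N]$, and a query applies the unitary $U_x|y\rangle|a\rangle=|y\rangle|a\oplus \mathsf{GT}_N(x,y)\rangle$ on $\mathbb C^N\otimes\mathbb C^2$ (tensored with the identity on a workspace of arbitrary finite dimension). An algorithm starts in a fixed state, alternates queries with unitaries that do not depend on $x$, and produces its output by a final measurement. Let $Q^{\mathrm{oip}}(\mathsf{GT}_N)$ be the minimum number of queries made by such an algorithm which, for every $x\in[N]$, outputs $x$ with failure probability at most $1/3$. Theorem. $Q^{\mathrm{oip}}(\mathsf{GT}_N)\ge\Omega(\log N/\log\log N)$. That is, there is an absolute constant $c>0$ such that for all sufficiently large $N$, $$Q^{\mathrm{oip}}(\mathsf{GT}_N)\;\ge\; c\cdot\frac{\log_2 N}{\log_2\log_2 N}.$$ -/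

import Mathlib

open Filter Matrix
open scoped ENNReal

noncomputable section

/-- Labels of the computational basis of `ℂ^Y ⊗ ℂ^k ⊗ ℂ^d`: a query register, a response register
of dimension `k = |Z|` and a workspace of dimension `d`. -/
abbrev QBasis (Y : Type) (k d : ℕ) : Type := Y × ZMod k × Fin d

/-- The query operator `U_g` of `g : Y → ℤ/k`, tensored with the identity on the workspace:
`U_g |y⟩|a⟩|w⟩ = |y⟩|a + g y mod k⟩|w⟩`. The column of the matrix indexed by `b` is the image
of `|b⟩`. -/
def queryOperator {Y : Type} [DecidableEq Y] {k : ℕ} (d : ℕ) (g : Y → ZMod k) :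
    Matrix (QBasis Y k d) (QBasis Y k d) ℂ :=
  Matrix.of fun b' b => if b' = (b.1, b.2.1 + g b.1, b.2.2) then 1 else 0

/-- A quantum query algorithm with oracle `Y → ℤ/k` and outputs in `X`. It starts in a basis
state, applies `V 0`, and then `queries` times makes a query and applies the next input-independent
unitary. Finally all registers are measured in the computational basis and the outcome
`b` is decoded to the output `out b`. (Only `V 0, …, V queries` are used. The workspace may have any
finite dimension, so ancillas, intermediate measurements and general final measurements are
covered by the usual purification.) -/
structure QueryAlgorithm (X Y : Type) [Fintype Y] [DecidableEq Y] (k : ℕ) [NeZero k] where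
  queries : ℕ
  workDim : ℕ
  start : QBasis Y k workDim
  V : ℕ → Matrix.unitaryGroup (QBasis Y k workDim) ℂ
  out : QBasis Y k workDim → X

namespace QueryAlgorithm

variable {X Y : Type} [Fintype Y] [DecidableEq Y] {k : ℕ} [NeZero k]

/-- The state after `i` queries to `g`, each followed by the next unitary of the algorithm. -/
def stateAfter (A : QueryAlgorithm X Y k) (g : Y → ZMod k) : ℕ → (QBasis Y k A.workDim → ℂ)
  | 0 => (A.V 0 : Matrix _ _ ℂ) *ᵥ Pi.single A.start 1
  | i + 1 => (A.V (i + 1) : Matrix _ _ ℂ) *ᵥ (queryOperator A.workDim g *ᵥ A.stateAfter g i)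

/-- The probability that the algorithm, run with oracle `g`, outputs something other than `x`. -/
def failureProb [DecidableEq X] (A : QueryAlgorithm X Y k) (g : Y → ZMod k) (x : X) : ℝ :=
  ∑ b with A.out b ≠ x, ‖A.stateAfter g A.queries b‖ ^ 2

end QueryAlgorithm

/-- `Q^oip_ε(f)`: the least number of queries of a quantum algorithm that, for every `x`, given
oracle access to `f_x = f x`, outputs `x` with failure probability at most `ε`
(`⊤` if there is no such algorithm). -/
def Qoip {X Y : Type} [DecidableEq X] [Fintype Y] [DecidableEq Y] {k : ℕ} [NeZero k]
    (ε : ℝ) (f : X → Y → ZMod k) : ℕ∞ :=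
  ⨅ (A : QueryAlgorithm X Y k) (_ : ∀ x, A.failureProb (f x) x ≤ ε), (A.queries : ℕ∞)

/-- The greater-than function on an ordered set of size `N`: `1` if `x > y` and `0` otherwise. -/
def GT_fun (N : ℕ) (x y : Fin N) : ZMod 2 := if x > y then 1 else 0

end

open QueryAlgorithm

/-! ### The Schur test for the Hilbert matrix -/

/-! This is the weighted adversary method. Give each pair `x < y` the weight `1 / (y - x + 1)` and
track the weighted sum of overlaps of the two runs (`gtProgress`). It starts at `(N + 1) * harmonic
N - 2 * N`, at least `N * (log N - 2)`. A correct algorithm must end with at most `17/18` of that. A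
query at `z` separates `x` from `y` only when `x ≤ z < y`. The weights of such pairs form a
Hilbert-type matrix, bounded by the Schur test uniformly in `z`, so one query costs at most `4 * N`
(`gtProgress_sub_succ_le`). Hence at least `(log N - 2) / 72` queries are needed, which is stronger
than the stated bound. -/

theorem schur_term_le_telescope {m : ℝ} (hm : 0 < m) (j : ℕ) :
    √m / (√((j : ℝ) + 1) * (m + (j + 1))) ≤
      4 * (√((j : ℝ) + 1) / (√((j : ℝ) + 1) + √m)) - 4 * (√(j : ℝ) / (√(j : ℝ) + √m)) := by
  have hj : (0 : ℝ) ≤ j := Nat.cast_nonneg j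
  have hu : 0 < √((j : ℝ) + 1) := Real.sqrt_pos.2 (by linarith)
  have hs : 0 < √m := Real.sqrt_pos.2 hm
  have hv : 0 ≤ √(j : ℝ) := Real.sqrt_nonneg _
  have hvu : √(j : ℝ) ≤ √((j : ℝ) + 1) := Real.sqrt_le_sqrt (by linarith)
  have hu2 : √((j : ℝ) + 1) ^ 2 = j + 1 := Real.sq_sqrt (by linarith)
  have hs2 : √m ^ 2 = m := Real.sq_sqrt hm.le
  have hv2 : √(j : ℝ) ^ 2 = j := Real.sq_sqrt hj
  generalize √((j : ℝ) + 1) = u at *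
  generalize √m = s at *
  generalize √(j : ℝ) = v at *
  have huv : (u - v) * (u + v) = 1 := by nlinarith
  have hd : 1 ≤ (u - v) * (2 * u) := by nlinarith
  have hprod : (u + s) * (v + s) ≤ 2 * (s ^ 2 + u ^ 2) := by
    nlinarith [sq_nonneg (u - s)]
  -- Discrete form of comparing `√m / (√t (m + t))`, whose integral over `t > 0` is `π`, with the
  -- derivative of `4√t / (√t + √m)`; this explains the constant `4`.
  have key : 4 * (u / (u + s)) - 4 * (v / (v + s)) = 4 * s * (u - v) / ((u + s) * (v + s)) := by
    field_simp
    ring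
  rw [key, ← hu2, ← hs2, div_le_div_iff₀ (by positivity) (by positivity)]
  calc s * ((u + s) * (v + s)) ≤ s * (2 * (s ^ 2 + u ^ 2)) * 1 := by
        rw [mul_one]; gcongr
    _ ≤ s * (2 * (s ^ 2 + u ^ 2)) * ((u - v) * (2 * u)) := by gcongr
    _ = 4 * s * (u - v) * (u * (s ^ 2 + u ^ 2)) := by ring

theorem schur_sum_le {m : ℝ} (hm : 0 < m) (s : Finset ℕ) :
    ∑ j ∈ s, √m / (√((j : ℝ) + 1) * (m + (j + 1))) ≤ 4 := by
  have hs : 0 < √m := Real.sqrt_pos.2 hm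
  obtain ⟨n, hn⟩ := s.exists_nat_subset_range
  calc ∑ j ∈ s, √m / (√((j : ℝ) + 1) * (m + (j + 1)))
      ≤ ∑ j ∈ Finset.range n, √m / (√((j : ℝ) + 1) * (m + (j + 1))) :=
        Finset.sum_le_sum_of_subset_of_nonneg hn fun _ _ _ => by positivity
    _ ≤ ∑ j ∈ Finset.range n, (4 * (√((j + 1 : ℕ) : ℝ) / (√((j + 1 : ℕ) : ℝ) + √m)) -
          4 * (√(j : ℝ) / (√(j : ℝ) + √m))) :=
        Finset.sum_le_sum fun j _ => by
          push_cast
          exact schur_term_le_telescope hm j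
    _ = 4 * (√(n : ℝ) / (√(n : ℝ) + √m)) := by
        rw [Finset.sum_range_sub (fun j : ℕ => 4 * (√(j : ℝ) / (√(j : ℝ) + √m)))]
        simp
    _ ≤ 4 := by
        have : √(n : ℝ) / (√(n : ℝ) + √m) ≤ 1 :=
          div_le_one_of_le₀ (by linarith) (by positivity)
        linarith

theorem schur_sum_comp_le {ι : Type*} {m : ℝ} (hm : 0 < m) (s : Finset ι) (f : ι → ℕ)
    (hf : Set.InjOn f s) :
    ∑ i ∈ s, √m / (√((f i : ℝ) + 1) * (m + (f i + 1))) ≤ 4 := by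
  rw [← Finset.sum_image (f := fun j : ℕ => √m / (√((j : ℝ) + 1) * (m + (j + 1)))) hf]
  exact schur_sum_le hm _

/-! ### Inner products of query states -/

section States

variable {Y : Type} [Fintype Y] [DecidableEq Y] {k : ℕ} [NeZero k] {d : ℕ}

theorem queryOperator_mulVec (g : Y → ZMod k) (v : QBasis Y k d → ℂ) (b : QBasis Y k d) :
    (queryOperator d g *ᵥ v) b = v (b.1, b.2.1 - g b.1, b.2.2) := by
  rw [Matrix.mulVec, dotProduct, Finset.sum_eq_single (b.1, b.2.1 - g b.1, b.2.2)]
  · simp [queryOperator]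
  · rintro ⟨y, a, w⟩ - hne
    simp only [queryOperator, Matrix.of_apply]
    rw [if_neg, zero_mul]
    rintro rfl
    simp at hne
  · simp

/-- The probability of observing `y` in the query register. -/
noncomputable def queryMass (v : QBasis Y k d → ℂ) (y : Y) : ℝ := ∑ p : ZMod k × Fin d, ‖v (y, p)‖ ^ 2

omit [Fintype Y] [DecidableEq Y] in
theorem queryMass_nonneg (v : QBasis Y k d → ℂ) (y : Y) : 0 ≤ queryMass v y :=
  Finset.sum_nonneg fun _ _ => by positivity

omit [DecidableEq Y] in
theorem sum_queryMass (v : QBasis Y k d → ℂ) : ∑ y, queryMass v y = ∑ b, ‖v b‖ ^ 2 :=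
  (Fintype.sum_prod_type (fun b : QBasis Y k d => ‖v b‖ ^ 2)).symm

theorem sum_shift {M : Type*} [AddCommMonoid M] (c : ZMod k) (F : ZMod k × Fin d → M) :
    ∑ p : ZMod k × Fin d, F (p.1 - c, p.2) = ∑ p, F p :=
  Fintype.sum_equiv ((Equiv.subRight c).prodCongr (Equiv.refl _)) _ _ fun _ => rfl

theorem queryMass_queryOperator (g : Y → ZMod k) (v : QBasis Y k d → ℂ) (y : Y) :
    queryMass (queryOperator d g *ᵥ v) y = queryMass v y := by
  simp only [queryMass, queryOperator_mulVec]
  exact sum_shift (g y) fun p => ‖v (y, p)‖ ^ 2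

theorem norm_sum_star_mul_le {ι : Type*} (s : Finset ι) (u v : ι → ℂ) {r : ℝ} (hr : 0 < r) :
    ‖∑ i ∈ s, star (u i) * v i‖ ≤ (r * ∑ i ∈ s, ‖u i‖ ^ 2 + r⁻¹ * ∑ i ∈ s, ‖v i‖ ^ 2) / 2 := by
  refine (norm_sum_le _ _).trans ?_
  rw [Finset.mul_sum, Finset.mul_sum, ← Finset.sum_add_distrib, Finset.sum_div]
  refine Finset.sum_le_sum fun i _ => ?_
  rw [norm_mul, norm_star]
  have h : r * ‖u i‖ ^ 2 + r⁻¹ * ‖v i‖ ^ 2 - 2 * (‖u i‖ * ‖v i‖)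
      = r⁻¹ * (r * ‖u i‖ - ‖v i‖) ^ 2 := by
    field_simp
    ring
  have : 0 ≤ r⁻¹ * (r * ‖u i‖ - ‖v i‖) ^ 2 := by positivity
  linarith

/-- Where `g` and `h` agree, the query shifts both states alike and the contributions cancel.
Elsewhere the old and new terms each obey the same weighted AM-GM bound. The weights `r` stay free
to serve as Schur weights. -/
theorem inner_sub_inner_query_le (g h : Y → ZMod k) (u v : QBasis Y k d → ℂ) (r : Y → ℝ)
    (hr : ∀ y, 0 < r y) :
    (star u ⬝ᵥ v).re - (star (queryOperator d g *ᵥ u) ⬝ᵥ (queryOperator d h *ᵥ v)).re ≤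
      ∑ y with g y ≠ h y, (r y * queryMass u y + (r y)⁻¹ * queryMass v y) := by
  have split : ∀ u v : QBasis Y k d → ℂ,
      (star u ⬝ᵥ v).re = ∑ y, (∑ p : ZMod k × Fin d, star (u (y, p)) * v (y, p)).re := by
    intro u v
    rw [dotProduct, Fintype.sum_prod_type, Complex.re_sum]
    rfl
  rw [split, split, ← Finset.sum_sub_distrib, Finset.sum_filter]
  refine Finset.sum_le_sum fun y _ => ?_
  split_ifs with hy
  · have h1 := norm_sum_star_mul_le Finset.univ (fun p : ZMod k × Fin d => u (y, p))
      (fun p => v (y, p)) (hr y)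
    have h2 := norm_sum_star_mul_le Finset.univ
      (fun p : ZMod k × Fin d => (queryOperator d g *ᵥ u) (y, p))
      (fun p => (queryOperator d h *ᵥ v) (y, p)) (hr y)
    have e1 := queryMass_queryOperator g u y
    have e2 := queryMass_queryOperator h v y
    simp only [queryMass] at e1 e2 ⊢
    rw [e1, e2] at h2
    have h3 := (Complex.abs_re_le_norm _).trans h1
    have h4 := (Complex.abs_re_le_norm _).trans h2
    have := (abs_le.1 h3).2
    have := (abs_le.1 h4).1
    linarith
  · rw [not_not] at hy
    simp only [queryOperator_mulVec, ← hy]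
    rw [sum_shift (g y) fun p => star (u (y, p)) * v (y, p), sub_self]

theorem star_unitary_mulVec_dotProduct {n : Type*} [Fintype n] [DecidableEq n]
    (U : Matrix.unitaryGroup n ℂ) (u v : n → ℂ) :
    star ((U : Matrix n n ℂ) *ᵥ u) ⬝ᵥ ((U : Matrix n n ℂ) *ᵥ v) = star u ⬝ᵥ v := by
  have hU : star (U : Matrix n n ℂ) * (U : Matrix n n ℂ) = 1 := Matrix.mem_unitaryGroup_iff'.1 U.2
  rw [Matrix.star_mulVec, ← Matrix.dotProduct_mulVec, Matrix.mulVec_mulVec,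
    ← Matrix.star_eq_conjTranspose, hU, Matrix.one_mulVec]

theorem star_dotProduct_self_re {n : Type*} [Fintype n] (u : n → ℂ) :
    (star u ⬝ᵥ u).re = ∑ i, ‖u i‖ ^ 2 := by
  rw [dotProduct, Complex.re_sum]
  refine Finset.sum_congr rfl fun i _ => ?_
  rw [Pi.star_apply, ← Complex.normSq_eq_norm_sq, Complex.star_def, mul_comm, Complex.mul_conj,
    Complex.ofReal_re]

theorem sum_norm_sq_unitary_mulVec {n : Type*} [Fintype n] [DecidableEq n]
    (U : Matrix.unitaryGroup n ℂ) (u : n → ℂ) :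
    ∑ i, ‖((U : Matrix n n ℂ) *ᵥ u) i‖ ^ 2 = ∑ i, ‖u i‖ ^ 2 := by
  rw [← star_dotProduct_self_re, star_unitary_mulVec_dotProduct, star_dotProduct_self_re]

variable {X : Type} (A : QueryAlgorithm X Y k)

theorem sum_norm_sq_stateAfter (g : Y → ZMod k) (i : ℕ) : ∑ b, ‖A.stateAfter g i b‖ ^ 2 = 1 := by
  induction i with
  | zero =>
    rw [stateAfter, sum_norm_sq_unitary_mulVec, Finset.sum_eq_single A.start]
    · simp
    · intro b _ hb
      simp [Pi.single_eq_of_ne hb]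
    · simp
  | succ i ih =>
    rw [stateAfter, sum_norm_sq_unitary_mulVec, ← ih, ← sum_queryMass, ← sum_queryMass]
    simp only [queryMass_queryOperator]

theorem inner_stateAfter_zero (g h : Y → ZMod k) :
    (star (A.stateAfter g 0) ⬝ᵥ A.stateAfter h 0).re = 1 := by
  have : A.stateAfter h 0 = A.stateAfter g 0 := rfl
  rw [this, star_dotProduct_self_re, sum_norm_sq_stateAfter]

theorem inner_stateAfter_sub_succ_le (g h : Y → ZMod k) (i : ℕ) (r : Y → ℝ) (hr : ∀ y, 0 < r y) :
    (star (A.stateAfter g i) ⬝ᵥ A.stateAfter h i).re -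
        (star (A.stateAfter g (i + 1)) ⬝ᵥ A.stateAfter h (i + 1)).re ≤
      ∑ y with g y ≠ h y, (r y * queryMass (A.stateAfter g i) y +
        (r y)⁻¹ * queryMass (A.stateAfter h i) y) := by
  rw [stateAfter, stateAfter, star_unitary_mulVec_dotProduct]
  exact inner_sub_inner_query_le g h _ _ r hr

/-- Final states that decode to different outputs with failure probability at most `1/3` are
bounded away from each other. -/
theorem inner_stateAfter_queries_le [DecidableEq X] (g h : Y → ZMod k) {x y : X} (hxy : x ≠ y)
    (hx : A.failureProb g x ≤ 1 / 3) (hy : A.failureProb h y ≤ 1 / 3) :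
    (star (A.stateAfter g A.queries) ⬝ᵥ A.stateAfter h A.queries).re ≤ 17 / 18 := by
  have nu := sum_norm_sq_stateAfter A g A.queries
  have nv := sum_norm_sq_stateAfter A h A.queries
  unfold failureProb at hx hy
  generalize A.stateAfter g A.queries = u at *
  generalize A.stateAfter h A.queries = v at *
  have hy' : ∑ b with A.out b = x, ‖v b‖ ^ 2 ≤ 1 / 3 := by
    refine le_trans (Finset.sum_le_sum_of_subset_of_nonneg ?_ fun _ _ _ => by positivity) hy
    intro b hb
    simp only [Finset.mem_filter, Finset.mem_univ, true_and] at hb ⊢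
    rw [hb]
    exact hxy
  rw [← Finset.sum_filter_add_sum_filter_not _ (fun b => A.out b = x)] at nu nv
  -- `3/4` is a rational stand-in for the optimal `1/√2`. The total is at most `(25/12 - 7/12 * (2/3
  -- - 1/3)) / 2 = 17/18`.
  have h1 := norm_sum_star_mul_le (Finset.univ.filter fun b => A.out b = x) u v
    (r := 3 / 4) (by norm_num)
  have h2 := norm_sum_star_mul_le (Finset.univ.filter fun b => ¬ A.out b = x) u v
    (r := 4 / 3) (by norm_num)
  have h3 : star u ⬝ᵥ v = ∑ b with A.out b = x, star (u b) * v b +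
      ∑ b with ¬ A.out b = x, star (u b) * v b :=
    (Finset.sum_filter_add_sum_filter_not _ _ _).symm
  have h4 := (Complex.re_le_norm _).trans ((norm_add_le _ _).trans (add_le_add h1 h2))
  rw [← h3] at h4
  norm_num at h4
  simp only [ne_eq] at hx
  linarith

end States

/-! ### The adversary bound for ordered search -/

section OrderedSearch

variable {N : ℕ}

/-- The adversary weight of the pair `x < y`. -/
noncomputable def gtWeight (x y : Fin N) : ℝ := 1 / ((y : ℝ) - x + 1)

theorem gtWeight_pos {x y : Fin N} (h : x < y) : 0 < gtWeight x y := by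
  have : (x : ℝ) < y := by exact_mod_cast h
  unfold gtWeight
  exact one_div_pos.2 (by linarith)

theorem GT_fun_ne_iff {x y : Fin N} (h : x < y) (z : Fin N) :
    GT_fun N x z ≠ GT_fun N y z ↔ x ≤ z ∧ z < y := by
  unfold GT_fun
  by_cases h1 : z < x
  · simp [h1, h1.trans h, h1.not_ge]
  · by_cases h2 : z < y
    · simp [h1, h2, not_lt.1 h1]
    · simp [h1, h2]

/-- With `m = z - x + 1` and `j = y - z - 1` one has `m + (j + 1) = y - x + 1`, so this is a Schur
row sum. -/
theorem sum_gtWeight_left (x z : Fin N) (hxz : x ≤ z) :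
    ∑ y with z < y, gtWeight x y * (√((z : ℝ) - x + 1) / √((y : ℝ) - z)) ≤ 4 := by
  have hxz' : (x : ℝ) ≤ z := by exact_mod_cast hxz
  refine le_trans (le_of_eq ?_) (schur_sum_comp_le (m := (z : ℝ) - x + 1) (by linarith)
    (Finset.univ.filter fun y => z < y) (fun y : Fin N => (y : ℕ) - z - 1) ?_)
  · refine Finset.sum_congr rfl fun y hy => ?_
    have hzy : z < y := by simpa using hy
    have e : (((y : ℕ) - z - 1 : ℕ) : ℝ) + 1 = (y : ℝ) - z := by
      have : (y : ℕ) - z - 1 + 1 + z = (y : ℕ) := by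
        have : (z : ℕ) < y := hzy
        omega
      rw [eq_sub_iff_add_eq]
      exact_mod_cast this
    rw [e, gtWeight, div_mul_div_comm, one_mul]
    congr 1
    ring
  · intro a ha b hb hab
    simp only [Finset.coe_filter, Finset.mem_univ, true_and, Set.mem_ofPred_eq, Fin.lt_def] at ha hb
    simp only at hab
    ext
    omega

theorem sum_gtWeight_right (y z : Fin N) (hzy : z < y) :
    ∑ x with x ≤ z, gtWeight x y * (√((z : ℝ) - x + 1) / √((y : ℝ) - z))⁻¹ ≤ 4 := by
  have hzy' : (z : ℝ) < y := by exact_mod_cast hzy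
  refine le_trans (le_of_eq ?_) (schur_sum_comp_le (m := (y : ℝ) - z) (by linarith)
    (Finset.univ.filter fun x => x ≤ z) (fun x : Fin N => (z : ℕ) - x) ?_)
  · refine Finset.sum_congr rfl fun x hx => ?_
    have hxz : x ≤ z := by simpa using hx
    have e : (((z : ℕ) - x : ℕ) : ℝ) = (z : ℝ) - x := Nat.cast_sub hxz
    rw [e, gtWeight, inv_div, div_mul_div_comm, one_mul]
    congr 1
    ring
  · intro a ha b hb hab
    simp only [Finset.coe_filter, Finset.mem_univ, true_and, Set.mem_ofPred_eq, Fin.le_def] at ha hb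
    simp only at hab
    ext
    omega

/-- Row sums charge only indices `≤ z` and column sums only indices `> z`. Each index is charged
once, so the factor is `4` and not `8`. -/
theorem sum_sum_gtWeight_le (a : Fin N → ℝ) (ha : ∀ x, 0 ≤ a x) (z : Fin N) :
    ∑ x with x ≤ z, ∑ y with z < y, gtWeight x y *
      (√((z : ℝ) - x + 1) / √((y : ℝ) - z) * a x +
        (√((z : ℝ) - x + 1) / √((y : ℝ) - z))⁻¹ * a y) ≤ 4 * ∑ x, a x := by
  have h1 : ∑ x with x ≤ z, ∑ y with z < y,
      gtWeight x y * (√((z : ℝ) - x + 1) / √((y : ℝ) - z)) * a x ≤ ∑ x with x ≤ z, 4 * a x := by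
    refine Finset.sum_le_sum fun x hx => ?_
    rw [← Finset.sum_mul]
    exact mul_le_mul_of_nonneg_right (sum_gtWeight_left x z (by simpa using hx)) (ha x)
  have h2 : ∑ x with x ≤ z, ∑ y with z < y,
      gtWeight x y * (√((z : ℝ) - x + 1) / √((y : ℝ) - z))⁻¹ * a y ≤
        ∑ y with ¬ y ≤ z, 4 * a y := by
    rw [Finset.sum_comm]
    simp only [not_le]
    refine Finset.sum_le_sum fun y hy => ?_
    rw [← Finset.sum_mul]
    exact mul_le_mul_of_nonneg_right (sum_gtWeight_right y z (by simpa using hy)) (ha y)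
  rw [Finset.mul_sum, ← Finset.sum_filter_add_sum_filter_not Finset.univ (fun x => x ≤ z)]
  refine le_trans (le_of_eq ?_) (add_le_add h1 h2)
  simp only [← Finset.sum_add_distrib]
  refine Finset.sum_congr rfl fun x _ => Finset.sum_congr rfl fun y _ => ?_
  ring

theorem sum_between_comm (F : Fin N → Fin N → Fin N → ℝ) :
    ∑ x, ∑ y with x < y, ∑ z with x ≤ z ∧ z < y, F x y z =
      ∑ z, ∑ x with x ≤ z, ∑ y with z < y, F x y z := by
  have h1 : ∀ x, ∑ y with x < y, ∑ z with x ≤ z ∧ z < y, F x y z =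
      ∑ z with x ≤ z, ∑ y with z < y, F x y z := fun x =>
    Finset.sum_comm' fun y z => by
      simp only [Finset.mem_filter, Finset.mem_univ, true_and]
      exact ⟨fun h => ⟨h.2.2, h.2.1⟩, fun h => ⟨h.2.trans_lt h.1, h.2, h.1⟩⟩
  simp only [h1]
  exact Finset.sum_comm' fun x z => by simp

variable (A : QueryAlgorithm (Fin N) (Fin N) 2)

/-- The weighted sum of the overlaps of the states after `i` queries. -/
noncomputable def gtProgress (i : ℕ) : ℝ := ∑ x, ∑ y with x < y, gtWeight x y *
  (star (A.stateAfter (GT_fun N x) i) ⬝ᵥ A.stateAfter (GT_fun N y) i).re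

theorem gtProgress_zero : gtProgress A 0 = ∑ x : Fin N, ∑ y with x < y, gtWeight x y := by
  simp only [gtProgress, inner_stateAfter_zero, mul_one]

theorem gtProgress_sub_succ_le (i : ℕ) : gtProgress A i - gtProgress A (i + 1) ≤ 4 * N := by
  -- The value `1` off the separating range only secures positivity.
  let R : Fin N → Fin N → Fin N → ℝ := fun x y z =>
    if x ≤ z ∧ z < y then √((z : ℝ) - x + 1) / √((y : ℝ) - z) else 1
  have hR : ∀ x y z, 0 < R x y z := by
    intro x y z
    simp only [R]
    split_ifs with h
    · have h1 : (x : ℝ) ≤ z := by exact_mod_cast h.1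
      have h2 : (z : ℝ) < y := by exact_mod_cast h.2
      exact div_pos (Real.sqrt_pos.2 (by linarith)) (Real.sqrt_pos.2 (by linarith))
    · exact one_pos
  let M : Fin N → Fin N → ℝ := fun x z => queryMass (A.stateAfter (GT_fun N x) i) z
  calc gtProgress A i - gtProgress A (i + 1)
      ≤ ∑ x : Fin N, ∑ y with x < y, ∑ z with x ≤ z ∧ z < y, gtWeight x y *
          (√((z : ℝ) - x + 1) / √((y : ℝ) - z) * M x z +
            (√((z : ℝ) - x + 1) / √((y : ℝ) - z))⁻¹ * M y z) := by
        simp only [gtProgress, ← Finset.sum_sub_distrib, ← mul_sub]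
        refine Finset.sum_le_sum fun x _ => Finset.sum_le_sum fun y hy => ?_
        have hxy : x < y := by simpa using hy
        rw [← Finset.mul_sum]
        refine mul_le_mul_of_nonneg_left ?_ (gtWeight_pos hxy).le
        refine (inner_stateAfter_sub_succ_le A _ _ i (R x y) (hR x y)).trans (le_of_eq ?_)
        refine Finset.sum_congr (by simp only [GT_fun_ne_iff hxy]) fun z hz => ?_
        have hz' : x ≤ z ∧ z < y := by simpa using hz
        simp only [R, if_pos hz', M]
    _ = ∑ z : Fin N, ∑ x with x ≤ z, ∑ y with z < y, gtWeight x y *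
          (√((z : ℝ) - x + 1) / √((y : ℝ) - z) * M x z +
            (√((z : ℝ) - x + 1) / √((y : ℝ) - z))⁻¹ * M y z) :=
        sum_between_comm _
    _ ≤ ∑ z : Fin N, 4 * ∑ x, M x z :=
        Finset.sum_le_sum fun z _ =>
          sum_sum_gtWeight_le (fun x => M x z) (fun x => queryMass_nonneg _ z) z
    _ = 4 * N := by
        rw [← Finset.mul_sum, Finset.sum_comm]
        simp only [M, sum_queryMass, sum_norm_sq_stateAfter]
        simp

theorem gtProgress_queries_le (hA : ∀ x, A.failureProb (GT_fun N x) x ≤ 1 / 3) :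
    gtProgress A A.queries ≤ 17 / 18 * gtProgress A 0 := by
  rw [gtProgress_zero, gtProgress, Finset.mul_sum]
  refine Finset.sum_le_sum fun x _ => ?_
  rw [Finset.mul_sum]
  refine Finset.sum_le_sum fun y hy => ?_
  have hxy : x < y := by simpa using hy
  rw [mul_comm]
  exact mul_le_mul_of_nonneg_right
    (inner_stateAfter_queries_le A _ _ hxy.ne (hA x) (hA y)) (gtWeight_pos hxy).le

/-! ### Harmonic sums and the initial progress -/

theorem sum_range_harmonic (n : ℕ) :
    ∑ j ∈ Finset.range n, harmonic (j + 1) = (n + 1) * harmonic n - n := by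
  induction n with
  | zero => simp
  | succ n ih =>
    rw [Finset.sum_range_succ, ih, harmonic_succ]
    push_cast
    have : (n : ℚ) + 1 ≠ 0 := by positivity
    field_simp
    ring

theorem sum_gtWeight_eq_harmonic (y : Fin N) :
    ∑ x with x < y, gtWeight x y = (harmonic (y + 1) : ℝ) - 1 := by
  have h1 : ∑ x with x < y, gtWeight x y =
      ∑ i ∈ Finset.range y, 1 / ((y : ℝ) - i + 1) := by
    refine Finset.sum_bij (fun x _ => (x : ℕ)) ?_ ?_ ?_ ?_
    · intro x hx
      exact Finset.mem_range.2 (Finset.mem_filter.1 hx).2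
    · intro a _ b _ h
      exact Fin.ext h
    · intro i hi
      have hi' : i < (y : ℕ) := by simpa using hi
      exact ⟨⟨i, hi'.trans y.2⟩, Finset.mem_filter.2 ⟨Finset.mem_univ _, hi'⟩, rfl⟩
    · intro x _
      rfl
  -- Reflection sums over the distance `y - x`; peeling off the first harmonic term accounts for the
  -- `- 1`.
  rw [h1, ← Finset.sum_range_reflect, harmonic, Finset.sum_range_succ']
  push_cast
  simp only [inv_one, add_sub_cancel_right]
  refine Finset.sum_congr rfl fun j hj => ?_
  have hj' : j + 1 ≤ (y : ℕ) := by simpa using hj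
  rw [Nat.sub_sub, Nat.cast_sub (by omega), one_div]
  congr 1
  push_cast
  ring

theorem le_gtProgress_zero : N * (Real.log N - 2) ≤ gtProgress A 0 := by
  have h : gtProgress A 0 = (N + 1) * (harmonic N : ℝ) - 2 * N := by
    have h2 : ∑ x : Fin N, ∑ y with x < y, gtWeight x y =
        ∑ y : Fin N, ∑ x with x < y, gtWeight x y := by
      simp only [Finset.sum_filter]
      exact Finset.sum_comm
    rw [gtProgress_zero, h2]
    simp only [sum_gtWeight_eq_harmonic, Finset.sum_sub_distrib]
    rw [Fin.sum_univ_eq_sum_range (fun j => (harmonic (j + 1) : ℝ))]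
    have h3 := congrArg (fun q : ℚ => (q : ℝ)) (sum_range_harmonic N)
    push_cast at h3
    rw [h3]
    simp
    ring
  rcases Nat.eq_zero_or_pos N with hN | hN
  · subst hN
    simp [h]
  have hN' : (0 : ℝ) < N := by exact_mod_cast hN
  have h4 : Real.log N ≤ harmonic N :=
    (Real.log_le_log hN' (by simp)).trans (log_add_one_le_harmonic N)
  have h5 : 0 ≤ Real.log N := Real.log_natCast_nonneg N
  rw [h]
  nlinarith

theorem log_sub_two_le_queries (hN : 0 < N) (hA : ∀ x, A.failureProb (GT_fun N x) x ≤ 1 / 3) :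
    (Real.log N - 2) / 72 ≤ A.queries := by
  have h1 : ∀ i : ℕ, gtProgress A 0 - gtProgress A i ≤ i * (4 * N) := by
    intro i
    induction i with
    | zero => simp
    | succ i ih =>
      have := gtProgress_sub_succ_le A i
      push_cast
      linarith
  have h2 := h1 A.queries
  have h3 := gtProgress_queries_le A hA
  have h4 := le_gtProgress_zero A
  have hN' : (0 : ℝ) < N := by exact_mod_cast hN
  -- At least `1/18` of the initial progress is lost, at most `4 * N` per query: `72 = 18 * 4`.
  have h5 : (N : ℝ) * ((Real.log N - 2) / 72) ≤ N * A.queries := by linarith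
  exact le_of_mul_le_mul_left h5 hN'

end OrderedSearch

/-! ### Passage to the stated asymptotic bound -/

theorem mainTheorem5 :
    ∃ c : ℝ, 0 < c ∧ ∀ᶠ N : ℕ in atTop,
      ENNReal.ofReal (c * (Real.logb 2 N / Real.logb 2 (Real.logb 2 N))) ≤
        ((Qoip (1 / 3) (GT_fun N) : ℕ∞) : ℝ≥0∞) := by
  refine ⟨1 / 288, by norm_num, ?_⟩
  have hlog : Tendsto (fun N : ℕ => Real.log N) atTop atTop :=
    Real.tendsto_log_atTop.comp tendsto_natCast_atTop_atTop
  filter_upwards [hlog.eventually_ge_atTop 4, eventually_gt_atTop 0] with N hN hpos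
  have hl2 : 0 < Real.log 2 := Real.log_pos (by norm_num)
  have hl2' : 1 / 2 < Real.log 2 := by linarith [Real.log_two_gt_d9]
  have hl2'' : Real.log 2 < 1 := by linarith [Real.log_two_lt_d9]
  have hL : 4 ≤ Real.logb 2 N := by
    rw [Real.logb, le_div_iff₀ hl2]
    linarith
  have hL2 : Real.logb 2 N ≤ 2 * Real.log N := by
    rw [Real.logb, div_le_iff₀ hl2]
    nlinarith
  have hLL : 1 ≤ Real.logb 2 (Real.logb 2 N) := by
    rw [Real.le_logb_iff_rpow_le (by norm_num) (by linarith)]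
    norm_num
    linarith
  set q : ℝ := 1 / 288 * (Real.logb 2 N / Real.logb 2 (Real.logb 2 N))
  -- The iterated logarithm is at least `1` and is dropped. Then `2 * log N / 288 ≤ (log N - 2) /
  -- 72` is exactly `log N ≥ 4`.
  have hq : q ≤ (Real.log N - 2) / 72 := by
    have : Real.logb 2 N / Real.logb 2 (Real.logb 2 N) ≤ Real.logb 2 N :=
      div_le_self (by linarith) hLL
    simp only [q]
    linarith
  have hK : ((⌈q⌉₊ : ℕ) : ℕ∞) ≤ Qoip (1 / 3) (GT_fun N) := by
    refine le_iInf₂ fun A hA => ?_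
    exact_mod_cast Nat.ceil_le.2 (hq.trans (log_sub_two_le_queries A hpos hA))
  calc ENNReal.ofReal q ≤ ((⌈q⌉₊ : ℕ) : ℝ≥0∞) := by
        rw [← ENNReal.ofReal_natCast]
        exact ENNReal.ofReal_le_ofReal (Nat.le_ceil q)
    _ = (((⌈q⌉₊ : ℕ) : ℕ∞) : ℝ≥0∞) := by simp
    _ ≤ _ := ENat.toENNReal_le.2 hK
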